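/- **Setting.** Let $\Omega_1'$ be a set of unary operations and let $\Omega_2'=\{*,*^\circ\}$ be a set of binary operations closed under formal opposites, $x*^\circ y=y*x$. Let $\mathcal C_G$ be the category of groups $(A,+,-,0)$ (not necessarily commutative) with operations $\Omega_1'\cup\Omega_2'$ such that $x*(y+z)=x*y+x*z$, $\omega(x+y)=\omega(x)+\omega(y)$ and $\omega(x)*y=\omega(x*y)$ for all $\omega\in\Omega_1'$, $*\in\Omega_2'$. A *category of interest* $\mathcal C$ is a full subcategory of such a $\mathcal C_G$ given by a set of identities, such that in all its objects 1. $x_1+(x_2*x_3)=(x_2*x_3)+x_1$ for each $*\in\Omega_2'$; 2. for each $(*,\bar *)\in\Omega_2'\times\Omega_2'$ there is a word $W=W_{*,\bar *}$ in the group operations and the operations of $\Omega_1'$ such that $(x_1*x_2)\,\bar *\,x_3=W\big(x_1(x_2x_3),x_1(x_3x_2),(x_2x_3)x_1,(x_3x_2)x_1,x_2(x_1x_3),x_2(x_3x_1),(x_1x_3)x_2,(x_3x_1)x_2\big)$, where each juxtaposition stands for an operation in $\Omega_2'$ (each of the eight products may occur with several choices of operations). Fix such words, choosing one operation out of each pair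 $\{*,*^\circ\}$ as first operation and using for $*^\circ$ the words of $*$ with $x_1,x_2$ exchanged. For $B,X\in\mathcal C$ let $\mathrm{Act}(B,X)\cong\mathrm{SplExt}(B,X)$ be the set of isomorphism classes of split extensions $X\xrightarrow{k}A\underset{\beta}{\overset{\alpha}{\rightleftarrows}}B$ ($\alpha\beta=\mathrm{id}_B$, $k=\ker\alpha$) in $\mathcal C$; it is a functor $\mathcal C^{op}\to\mathbf{Set}$ of $B$ by pullback. Such a split extension gives the derived action $b\cdot a=\beta(b)+a-\beta(b)$, $b*a=\beta(b)*a$ ($*\in\Omega_2'$) of $B$ on $X$, where $X$ is viewed inside $A$ via $k$. *The universal strict general actor* $\mathrm{USGA}(X)$. Each element $b$ of an object $B$ acting on $X$ gives a family $\bar b$ of self-maps of $X$: the maps $a\mapsto b*a$ for $*\in\Omega_2'$, and the maps $a\mapsto(\omega_1\cdots\omega_n b)\cdot a$ for all $n\ge 0$, $\omega_i\in\Omega_1'$. On such families $t,t'$ of self-maps, operations are defined by $(t+t')\cdot a=t\cdot(t'\cdot a)$, $(t+t')*a=t*a+t'*a$, $(\omega t)*a=\omega(t*a)$, with $(\omega_1\cdots\omega_n(\omega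 t))\cdot a$ equal to the component of $t$ at $\omega_1\cdots\omega_n\omega$; and $(\omega_1\cdots\omega_n(t*t'))\cdot a=a$, $(t*t')\,\bar *\,a=W_{*,\bar *}\big(t(t'a),t(at'),(t'a)t,(at')t,t'(ta),t'(at),(ta)t',(at)t'\big)$, where $a*t:=t*^\circ a$. $\mathrm{USGA}(X)$ is the set of all families obtained from the $\bar b$ ($b\in B$, all split extensions of all $B\in\mathcal C$ by $X$) by repeatedly applying these operations; it is an object of $\mathcal C_G$. **Proposition.** Let $\mathcal C$ be a category of interest and let $X$ be an object of $\mathcal C$. For every $B\in\mathcal C$ and every action $\xi$ of $B$ on $X$ there is a unique morphism $\tau_B(\xi)\colon B\to\mathrm{USGA}(X)$ of $\mathcal C_G$ such that $\tau_B(\xi)(b)\cdot a=b\cdot a$ and $\tau_B(\xi)(b)*a=b*a$ for all $b\in B$, $a\in X$, $*\in\Omega_2'$, and the maps $\tau_B$ form a monomorphism of functors $$\tau\colon\mathrm{Act}(-,X)\rightarrowtail\mathrm{Hom}_{\mathcal C_G}(-,\mathrm{USGA}(X)).$$ If moreover $\mathrm{USGA}(X)$ is an object of $\mathcal C$, then $(\mathrm{USGA}(X),\tau)$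 is a weak representation of $\mathrm{Act}(-,X)$, that is, $\tau$ is a monomorphism of functors $\mathrm{Act}(-,X)\rightarrowtail\mathrm{Hom}_{\mathcal C}(-,\mathrm{USGA}(X))$. **Corollary.** If $\mathrm{USGA}(X)$ is an object of $\mathcal C$ for every $X$ in $\mathcal C$, then $\mathcal C$ is weakly action representable: every object $X$ of $\mathcal C$ admits an object $T$ of $\mathcal C$ and a monomorphism of functors $\mathrm{Act}(-,X)\rightarrowtail\mathrm{Hom}_{\mathcal C}(-,T)$. -/

import Mathlib

open CategoryTheory CategoryTheory.Limits Opposite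

universe v w u

/-! ## Groups with operations -/

/-- The operations of a category of groups with operations, besides the group operations
`0`, `-`, `+`: the unary operations `Ω₁' = Un` and the binary operations
`Ω₂' = {*, *° : * ∈ Bin}`, where `x *° y = y * x`. -/
structure Signature where
  Un : Type u
  Bin : Type u

/-- The set `Ω₂'`: the pair `(s, false)` stands for `s`, and `(s, true)` for its opposite `s°`. -/
abbrev Signature.Op (S : Signature.{u}) : Type u := S.Bin × Bool

/-- The opposite operation `*°` of an operation `*`. -/
def Signature.Op.opp {S : Signature.{u}} (p : S.Op) : S.Op := (p.1, !p.2)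

/-- The structure of an object of `C_G`: a group (written additively, not necessarily
commutative) with further operations, such that for each `* ∈ Ω₂'` one has
`x * (y + z) = x * y + x * z`, and for each `ω ∈ Ω₁'`, `* ∈ Ω₂'` one has
`ω (x + y) = ω x + ω y` and `ω x * y = ω (x * y)`. As `Ω₂'` is closed under opposites,
the laws for `Ω₂'` amount to two laws for each operation in `Bin`. -/
class GAlg (S : Signature.{u}) (A : Type u) [AddGroup A] where
  un : S.Un → A → A
  bin : S.Bin → A → A → A
  bin_add : ∀ s x y z, bin s x (y + z) = bin s x y + bin s x z
  add_bin : ∀ s x y z, bin s (x + y) z = bin s x z + bin s y z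
  un_add : ∀ ω x y, un ω (x + y) = un ω x + un ω y
  un_bin : ∀ ω s x y, bin s (un ω x) y = un ω (bin s x y)
  bin_un : ∀ ω s x y, bin s x (un ω y) = un ω (bin s x y)

namespace GAlg

variable {S : Signature.{u}} {A : Type u} [AddGroup A] [GAlg S A]

/-- The action of an arbitrary operation in `Ω₂'`. -/
def op (p : S.Op) (x y : A) : A :=
  match p with
  | (s, false) => bin s x y
  | (s, true) => bin s y x

/-- The composite unary operation `ω₁ ω₂ ⋯ ωₙ`, for a list `[ω₁, …, ωₙ]`. -/
def uns : List S.Un → A → A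
  | [], x => x
  | ω :: l, x => un ω (uns l x)

theorem un_zero (ω : S.Un) : un ω (0 : A) = 0 := by
  have h := un_add ω (0 : A) 0
  simpa using h

theorem bin_zero (s : S.Bin) (x : A) : bin s x 0 = 0 := by
  have h := bin_add s x 0 0
  simpa using h

theorem zero_bin (s : S.Bin) (x : A) : bin s 0 x = 0 := by
  have h := add_bin s 0 0 x
  simpa using h

theorem un_neg (ω : S.Un) (x : A) : un ω (-x) = -un ω x := by
  have h := un_add ω (-x) x
  rw [neg_add_cancel, un_zero] at h
  exact eq_neg_of_add_eq_zero_left h.symm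

end GAlg

/-- The objects of `C_G`. -/
structure GCat (S : Signature.{u}) : Type (u + 1) where
  carrier : Type u
  [grp : AddGroup carrier]
  [alg : GAlg S carrier]

namespace GCat

variable {S : Signature.{u}}

instance : CoeSort (GCat S) (Type u) := ⟨GCat.carrier⟩

instance (A : GCat S) : AddGroup A := A.grp

instance (A : GCat S) : GAlg S A := A.alg

/-- The morphisms of `C_G`: the maps that respect all operations (compatibility with `0`, `-`
and the opposite operations is automatic). -/
@[ext]
structure Hom (A B : GCat S) where
  toFun : A → B
  map_add : ∀ x y, toFun (x + y) = toFun x + toFun y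
  map_un : ∀ (ω : S.Un) x, toFun (GAlg.un ω x) = GAlg.un ω (toFun x)
  map_bin : ∀ (s : S.Bin) x y, toFun (GAlg.bin s x y) = GAlg.bin s (toFun x) (toFun y)

instance (A B : GCat S) : FunLike (Hom A B) A B where
  coe := Hom.toFun
  coe_injective _ _ h := Hom.ext h

/-- The category `C_G`. -/
instance : Category (GCat S) where
  Hom A B := Hom A B
  id A := ⟨fun x => x, fun _ _ => rfl, fun _ _ => rfl, fun _ _ _ => rfl⟩
  comp f g :=
    { toFun := fun x => g.toFun (f.toFun x)
      map_add := fun x y => by rw [f.map_add, g.map_add]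
      map_un := fun ω x => by rw [f.map_un, g.map_un]
      map_bin := fun s x y => by rw [f.map_bin, g.map_bin] }

instance : ConcreteCategory (GCat S) (fun A B => Hom A B) where
  hom f := f
  ofHom f := f

theorem hom_ext {A B : GCat S} {f g : A ⟶ B} (h : ∀ x, f x = g x) : f = g :=
  Hom.ext (funext h)

theorem map_zero {A B : GCat S} (f : A ⟶ B) : f 0 = 0 := by
  have h := Hom.map_add f 0 0
  rw [add_zero] at h
  exact left_eq_add.mp h

theorem map_neg {A B : GCat S} (f : A ⟶ B) (x : A) : f (-x) = -f x := by
  have h := Hom.map_add f (-x) x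
  rw [neg_add_cancel] at h
  exact eq_neg_of_add_eq_zero_left (h.symm.trans (map_zero f))

/-- A nonempty subset of an object of `C_G` that is closed under all operations is again an
object of `C_G`. -/
def sub (A : GCat S) (P : A → Prop) (h0 : P 0) (hadd : ∀ x y, P x → P y → P (x + y))
    (hneg : ∀ x, P x → P (-x)) (hun : ∀ (ω : S.Un) x, P x → P (GAlg.un ω x))
    (hbin : ∀ (s : S.Bin) x y, P x → P y → P (GAlg.bin s x y)) : GCat S :=
  letI G : AddSubgroup A :=
    { carrier := {x | P x}
      zero_mem' := h0
      add_mem' := fun hx hy => hadd _ _ hx hy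
      neg_mem' := fun hx => hneg _ hx }
  { carrier := G
    alg :=
      { un := fun ω x => ⟨GAlg.un ω x.1, hun ω _ x.2⟩
        bin := fun s x y => ⟨GAlg.bin s x.1 y.1, hbin s _ _ x.2 y.2⟩
        bin_add := fun _ _ _ _ => Subtype.ext (GAlg.bin_add _ _ _ _)
        add_bin := fun _ _ _ _ => Subtype.ext (GAlg.add_bin _ _ _ _)
        un_add := fun _ _ _ => Subtype.ext (GAlg.un_add _ _ _)
        un_bin := fun _ _ _ _ => Subtype.ext (GAlg.un_bin _ _ _ _)
        bin_un := fun _ _ _ _ => Subtype.ext (GAlg.bin_un _ _ _ _) } }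

/-- The product of two objects of `C_G`. -/
def prod (A B : GCat S) : GCat S where
  carrier := A × B
  alg :=
    { un := fun ω x => (GAlg.un ω x.1, GAlg.un ω x.2)
      bin := fun s x y => (GAlg.bin s x.1 y.1, GAlg.bin s x.2 y.2)
      bin_add := fun _ _ _ _ => Prod.ext (GAlg.bin_add _ _ _ _) (GAlg.bin_add _ _ _ _)
      add_bin := fun _ _ _ _ => Prod.ext (GAlg.add_bin _ _ _ _) (GAlg.add_bin _ _ _ _)
      un_add := fun _ _ _ => Prod.ext (GAlg.un_add _ _ _) (GAlg.un_add _ _ _)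
      un_bin := fun _ _ _ _ => Prod.ext (GAlg.un_bin _ _ _ _) (GAlg.un_bin _ _ _ _)
      bin_un := fun _ _ _ _ => Prod.ext (GAlg.bin_un _ _ _ _) (GAlg.bin_un _ _ _ _) }

instance : HasZeroMorphisms (GCat S) where
  zero _ _ := ⟨{ toFun := fun _ => 0
                 map_add := fun _ _ => (add_zero 0).symm
                 map_un := fun ω _ => (GAlg.un_zero ω).symm
                 map_bin := fun s _ _ => (GAlg.bin_zero s 0).symm }⟩
  comp_zero _ _ := rfl
  zero_comp _ _ _ f := hom_ext fun _ => map_zero f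

end GCat

/-! ## Identities and varieties -/

/-- Terms in the operations `0`, `-`, `+`, `Un`, `Bin` and variables `x₀, x₁, …`. -/
inductive OpTerm (S : Signature.{u}) : Type u
  | var : ℕ → OpTerm S
  | zero : OpTerm S
  | neg : OpTerm S → OpTerm S
  | add : OpTerm S → OpTerm S → OpTerm S
  | un : S.Un → OpTerm S → OpTerm S
  | bin : S.Bin → OpTerm S → OpTerm S → OpTerm S

/-- The value of a term in an object of `C_G`. -/
def OpTerm.eval {S : Signature.{u}} {A : GCat S} (e : ℕ → A) : OpTerm S → A
  | var i => e i
  | zero => 0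
  | neg t => -t.eval e
  | add t t' => t.eval e + t'.eval e
  | un ω t => GAlg.un ω (t.eval e)
  | bin s t t' => GAlg.bin s (t.eval e) (t'.eval e)

theorem OpTerm.map_eval {S : Signature.{u}} {A B : GCat S} (f : A ⟶ B) (e : ℕ → A)
    (t : OpTerm S) : f (t.eval e) = t.eval fun i => f (e i) := by
  induction t with
  | var i => rfl
  | zero => exact GCat.map_zero f
  | neg t ih => exact (GCat.map_neg f _).trans (congrArg _ ih)
  | add t t' ih ih' => exact (GCat.Hom.map_add f _ _).trans (congrArg₂ _ ih ih')
  | un ω t ih => exact (GCat.Hom.map_un f _ _).trans (congrArg _ ih)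
  | bin s t t' ih ih' => exact (GCat.Hom.map_bin f _ _ _).trans (congrArg₂ _ ih ih')

/-- A set of identities; the identities that define `C_G` are always understood. -/
abbrev Identities (S : Signature.{u}) : Type u := Set (OpTerm S × OpTerm S)

/-- The objects of `C_G` that satisfy all the identities in `E`. -/
def Identities.Sat {S : Signature.{u}} (E : Identities S) : ObjectProperty (GCat S) :=
  fun A => ∀ p ∈ E, ∀ e : ℕ → A, p.1.eval e = p.2.eval e

/-- The category `C` of groups with operations given by a set of identities `E`: a full
subcategory of `C_G`. -/
abbrev Variety {S : Signature.{u}} (E : Identities S) : Type (u + 1) :=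
  E.Sat.FullSubcategory

namespace Variety

variable {S : Signature.{u}} {E : Identities S}

instance : CoeSort (Variety E) (Type u) := ⟨fun A => A.obj.carrier⟩

instance : HasZeroMorphisms (Variety E) where
  zero _ _ := ⟨⟨0⟩⟩
  comp_zero _ _ := ObjectProperty.hom_ext _ comp_zero
  zero_comp _ _ _ _ := ObjectProperty.hom_ext _ zero_comp

/-- The pullback of two morphisms, as a subobject of the product. -/
def pb {A B D : GCat S} (f : A ⟶ D) (g : B ⟶ D) : GCat S :=
  (A.prod B).sub (fun p => f p.1 = g p.2)
    ((GCat.map_zero f).trans (GCat.map_zero g).symm)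
    (fun x y hx hy => (GCat.Hom.map_add f x.1 y.1).trans
      ((congrArg₂ _ hx hy).trans (GCat.Hom.map_add g x.2 y.2).symm))
    (fun x hx => (GCat.map_neg f x.1).trans
      ((congrArg _ hx).trans (GCat.map_neg g x.2).symm))
    (fun ω x hx => (GCat.Hom.map_un f ω x.1).trans
      ((congrArg _ hx).trans (GCat.Hom.map_un g ω x.2).symm))
    (fun s x y hx hy => (GCat.Hom.map_bin f s x.1 y.1).trans
      ((congrArg₂ _ hx hy).trans (GCat.Hom.map_bin g s x.2 y.2).symm))

def pbFst {A B D : GCat S} (f : A ⟶ D) (g : B ⟶ D) : pb f g ⟶ A :=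
  GCat.Hom.mk (A := pb f g) (fun p => p.1.1) (fun _ _ => rfl) (fun _ _ => rfl)
    (fun _ _ _ => rfl)

def pbSnd {A B D : GCat S} (f : A ⟶ D) (g : B ⟶ D) : pb f g ⟶ B :=
  GCat.Hom.mk (A := pb f g) (fun p => p.1.2) (fun _ _ => rfl) (fun _ _ => rfl)
    (fun _ _ _ => rfl)

theorem pb_sat {A B D : Variety E} (f : A ⟶ D) (g : B ⟶ D) : E.Sat (pb f.hom g.hom) := by
  intro p hp e
  refine Subtype.ext (Prod.ext ?_ ?_)
  · have h := A.property p hp fun i => pbFst f.hom g.hom (e i)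
    rw [← OpTerm.map_eval, ← OpTerm.map_eval] at h
    exact h
  · have h := B.property p hp fun i => pbSnd f.hom g.hom (e i)
    rw [← OpTerm.map_eval, ← OpTerm.map_eval] at h
    exact h

def pbLift {A B D Z : GCat S} (f : A ⟶ D) (g : B ⟶ D) (a : Z ⟶ A) (b : Z ⟶ B)
    (h : ∀ z, f (a z) = g (b z)) : Z ⟶ pb f g :=
  GCat.Hom.mk (B := pb f g) (fun z => ⟨(a z, b z), h z⟩)
    (fun _ _ => Subtype.ext (Prod.ext (GCat.Hom.map_add a _ _) (GCat.Hom.map_add b _ _)))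
    (fun _ _ => Subtype.ext (Prod.ext (GCat.Hom.map_un a _ _) (GCat.Hom.map_un b _ _)))
    (fun _ _ _ => Subtype.ext (Prod.ext (GCat.Hom.map_bin a _ _ _) (GCat.Hom.map_bin b _ _ _)))

instance : HasPullbacks (Variety E) := by
  refine @hasPullbacks_of_hasLimit_cospan _ _ ?_
  intro A B D f g
  let P : Variety E := ⟨pb f.hom g.hom, pb_sat f g⟩
  let p₁ : P ⟶ A := ⟨pbFst f.hom g.hom⟩
  let p₂ : P ⟶ B := ⟨pbSnd f.hom g.hom⟩
  have w : p₁ ≫ f = p₂ ≫ g :=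
    ObjectProperty.hom_ext _ (GCat.hom_ext fun x => x.2)
  have hc (s : PullbackCone f g) (z : s.pt.obj) :
      f.hom (s.fst.hom z) = g.hom (s.snd.hom z) :=
    congrArg (fun m : s.pt ⟶ D => m.hom z) s.condition
  refine ⟨⟨⟨PullbackCone.mk p₁ p₂ w, PullbackCone.IsLimit.mk w
    (fun s => ⟨pbLift f.hom g.hom s.fst.hom s.snd.hom (hc s)⟩)
    (fun s => rfl) (fun s => rfl) ?_⟩⟩⟩
  intro s m h₁ h₂
  refine ObjectProperty.hom_ext _ (GCat.hom_ext fun z => Subtype.ext (Prod.ext ?_ ?_))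
  · exact congrArg (fun m : s.pt ⟶ A => m.hom z) h₁
  · exact congrArg (fun m : s.pt ⟶ B => m.hom z) h₂

end Variety

/-! ## Categories of interest -/

/-- The eight products of three elements `x₁`, `x₂`, `x₃` that may occur in the second axiom of
a category of interest. In each of them `p` is the outer and `q` the inner operation. -/
inductive Monomial (S : Signature.{u}) : Type u
  | m1_23 (p q : S.Op) : Monomial S
  | m1_32 (p q : S.Op) : Monomial S
  | m23_1 (p q : S.Op) : Monomial S
  | m32_1 (p q : S.Op) : Monomial S
  | m2_13 (p q : S.Op) : Monomial S
  | m2_31 (p q : S.Op) : Monomial S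
  | m13_2 (p q : S.Op) : Monomial S
  | m31_2 (p q : S.Op) : Monomial S

/-- The value of a monomial at three elements of an object of `C_G`. -/
def Monomial.eval {S : Signature.{u}} {A : GCat S} (x₁ x₂ x₃ : A) : Monomial S → A
  | m1_23 p q => GAlg.op p x₁ (GAlg.op q x₂ x₃)
  | m1_32 p q => GAlg.op p x₁ (GAlg.op q x₃ x₂)
  | m23_1 p q => GAlg.op p (GAlg.op q x₂ x₃) x₁
  | m32_1 p q => GAlg.op p (GAlg.op q x₃ x₂) x₁
  | m2_13 p q => GAlg.op p x₂ (GAlg.op q x₁ x₃)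
  | m2_31 p q => GAlg.op p x₂ (GAlg.op q x₃ x₁)
  | m13_2 p q => GAlg.op p (GAlg.op q x₁ x₃) x₂
  | m31_2 p q => GAlg.op p (GAlg.op q x₃ x₁) x₂

/-- Words in the monomials, formed with the group operations and the unary operations. -/
inductive OpWord (S : Signature.{u}) : Type u
  | mon : Monomial S → OpWord S
  | zero : OpWord S
  | neg : OpWord S → OpWord S
  | add : OpWord S → OpWord S → OpWord S
  | un : S.Un → OpWord S → OpWord S

/-- The value of a word in a group with unary operations `θ`, where `m` gives the values of the
monomials. -/
def OpWord.eval {S : Signature.{u}} {H : Type u} [AddGroup H] (θ : S.Un → H → H)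
    (m : Monomial S → H) : OpWord S → H
  | mon i => m i
  | zero => 0
  | neg W => -W.eval θ m
  | add W W' => W.eval θ m + W'.eval θ m
  | un ω W => θ ω (W.eval θ m)

/-- `(x₁ * x₂) *' x₃ = W(x₁(x₂x₃), x₁(x₃x₂), …, (x₃x₁)x₂)` holds in all objects of the category
given by `E`. -/
def IsProductWord {S : Signature.{u}} (E : Identities S) (p q : S.Op) (W : OpWord S) : Prop :=
  ∀ (A : Variety E) (x₁ x₂ x₃ : A.obj),
    GAlg.op q (GAlg.op p x₁ x₂) x₃ = W.eval GAlg.un (Monomial.eval x₁ x₂ x₃)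

/-- The category of groups with operations given by `E` is a category of interest. -/
structure IsCategoryOfInterest {S : Signature.{u}} (E : Identities S) : Prop where
  axiom1 : ∀ (A : Variety E) (p : S.Op) (x₁ x₂ x₃ : A.obj),
    x₁ + GAlg.op p x₂ x₃ = GAlg.op p x₂ x₃ + x₁
  axiom2 : ∀ p q : S.Op, ∃ W : OpWord S, IsProductWord E p q W

/-- A choice of words as in the second axiom. For `p = s°` one takes the word of `s` with
`x₁` and `x₂` exchanged, so only operations `s` in `Bin` are needed as first operation. -/
structure ProductWords {S : Signature.{u}} (E : Identities S) where
  word : S.Bin → S.Op → OpWord S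
  isProductWord : ∀ s q, IsProductWord E (s, false) q (word s q)

/-! ## Split extensions and weak representations -/

section SplitExtensions

variable {𝒞 : Type w} [Category.{v} 𝒞] [HasZeroMorphisms 𝒞]

/-- A split extension `X ⟶ A ⇄ B` of `B` by `X`. -/
structure SplitExt (B X : 𝒞) where
  A : 𝒞
  k : X ⟶ A
  α : A ⟶ B
  β : B ⟶ A
  section_comp : β ≫ α = 𝟙 B
  zero : k ≫ α = 0
  isKernel : Nonempty (IsLimit (KernelFork.ofι k zero))

/-- Isomorphism of split extensions of `B` by `X` (identical on `B` and on `X`). -/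
def SplitExt.Equivalent {B X : 𝒞} (e e' : SplitExt B X) : Prop :=
  ∃ i : e.A ≅ e'.A, e.k ≫ i.hom = e'.k ∧ i.hom ≫ e'.α = e.α ∧ e.β ≫ i.hom = e'.β

instance SplitExt.setoid (B X : 𝒞) : Setoid (SplitExt B X) where
  r := SplitExt.Equivalent
  iseqv :=
    { refl := fun e => ⟨Iso.refl _, by simp, by simp, by simp⟩
      symm := by
        rintro e e' ⟨i, h₁, h₂, h₃⟩
        exact ⟨i.symm, by simp [← h₁], by simp [← h₂], by simp [← h₃]⟩
      trans := by
        rintro e e' e'' ⟨i, h₁, h₂, h₃⟩ ⟨j, h₁', h₂', h₃'⟩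
        refine ⟨i ≪≫ j, ?_, ?_, ?_⟩
        · simp [reassoc_of% h₁, h₁']
        · simp [h₂', h₂]
        · simp [reassoc_of% h₃, h₃'] }

variable [HasPullbacks 𝒞]

attribute [local simp] pullback.map pullback.lift_fst pullback.lift_snd pullback.lift_fst_assoc
  pullback.lift_snd_assoc

/-- The change of base of a split extension along `f`, by pulling back. -/
noncomputable def SplitExt.baseChange {B B' X : 𝒞} (f : B' ⟶ B) (e : SplitExt B X) :
    SplitExt B' X where
  A := Limits.pullback e.α f
  k := pullback.lift e.k 0 (by simp [e.zero])
  α := pullback.snd e.α f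
  β := pullback.lift (f ≫ e.β) (𝟙 B') (by simp [e.section_comp])
  section_comp := pullback.lift_snd _ _ _
  zero := pullback.lift_snd _ _ _
  isKernel := by
    obtain ⟨h⟩ := e.isKernel
    have : Mono e.k := mono_of_isLimit_fork h
    have : Mono (pullback.lift e.k 0 (by simp [e.zero]) : X ⟶ Limits.pullback e.α f) :=
      mono_of_mono_fac (pullback.lift_fst _ _ _)
    refine ⟨KernelFork.IsLimit.ofι' _ _ fun {Z} g hg => ?_⟩
    have hz : (g ≫ pullback.fst e.α f) ≫ e.α = 0 := by
      rw [Category.assoc, pullback.condition, reassoc_of% hg, zero_comp]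
    obtain ⟨l, hl⟩ := KernelFork.IsLimit.lift' h _ hz
    refine ⟨l, pullback.hom_ext ?_ ?_⟩
    · rw [Category.assoc, pullback.lift_fst]
      exact hl
    · rw [Category.assoc, pullback.lift_snd, comp_zero, hg]

theorem SplitExt.baseChange_equiv {B B' X : 𝒞} (f : B' ⟶ B) {e e' : SplitExt B X}
    (h : e.Equivalent e') : (e.baseChange f).Equivalent (e'.baseChange f) := by
  obtain ⟨i, h₁, h₂, h₃⟩ := h
  have h₂' : i.inv ≫ e.α = e'.α := by rw [Iso.inv_comp_eq, h₂]
  let j : Limits.pullback e.α f ≅ Limits.pullback e'.α f :=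
    { hom := pullback.map e.α f e'.α f i.hom (𝟙 _) (𝟙 _) (by simp [h₂]) (by simp)
      inv := pullback.map e'.α f e.α f i.inv (𝟙 _) (𝟙 _) (by simp [h₂']) (by simp)
      hom_inv_id := by apply pullback.hom_ext <;> simp
      inv_hom_id := by
        apply pullback.hom_ext
        · rw [Category.assoc]
          simp
        · rw [Category.assoc]
          simp }
  refine ⟨j, ?_, ?_, ?_⟩
  · apply pullback.hom_ext <;> simp [SplitExt.baseChange, j, h₁]
  · simp [SplitExt.baseChange, j]
  · apply pullback.hom_ext <;> simp [SplitExt.baseChange, j, h₃]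

theorem SplitExt.baseChange_id {B X : 𝒞} (e : SplitExt B X) :
    (e.baseChange (𝟙 B)).Equivalent e := by
  let j : Limits.pullback e.α (𝟙 B) ≅ e.A :=
    { hom := pullback.fst _ _
      inv := pullback.lift (𝟙 _) e.α (by simp)
      hom_inv_id := by apply pullback.hom_ext <;> simp [pullback.condition]
      inv_hom_id := pullback.lift_fst _ _ _ }
  refine ⟨j, ?_, ?_, ?_⟩
  · simp [SplitExt.baseChange, j]
  · simp [SplitExt.baseChange, j, pullback.condition]
  · simp [SplitExt.baseChange, j]

theorem SplitExt.baseChange_comp {B B' B'' X : 𝒞} (g : B'' ⟶ B') (f : B' ⟶ B)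
    (e : SplitExt B X) :
    (e.baseChange (g ≫ f)).Equivalent ((e.baseChange f).baseChange g) := by
  let j : Limits.pullback e.α (g ≫ f) ≅ Limits.pullback (pullback.snd e.α f) g :=
    (pullbackLeftPullbackSndIso e.α f g).symm
  refine ⟨j, ?_, ?_, ?_⟩
  · apply pullback.hom_ext
    · apply pullback.hom_ext <;> simp [SplitExt.baseChange, j]
    · simp [SplitExt.baseChange, j]
  · simp [SplitExt.baseChange, j]
  · apply pullback.hom_ext
    · apply pullback.hom_ext <;> simp [SplitExt.baseChange, j]
    · simp [SplitExt.baseChange, j]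

/-- The functor `Act(-, X) ≅ SplExt(-, X)`: isomorphism classes of split extensions, with change
of base. -/
noncomputable def splExt (X : 𝒞) : 𝒞ᵒᵖ ⥤ Type (max v w) where
  obj B := Quotient (SplitExt.setoid (unop B) X)
  map f := ↾(Quotient.map (SplitExt.baseChange f.unop) fun _ _ h =>
    SplitExt.baseChange_equiv f.unop h)
  map_id B := by
    ext e
    induction e using Quotient.inductionOn with
    | h e => exact Quotient.sound (SplitExt.baseChange_id e)
  map_comp f g := by
    ext e
    induction e using Quotient.inductionOn with
    | h e => exact Quotient.sound (SplitExt.baseChange_comp g.unop f.unop e)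

/-- The pair `(T, τ)` is a weak representation of `SplExt(-, X)`: `τ` is a monomorphism of functors
`SplExt(-, X) ⟶ Hom(-, T)`. (The universe lift is needed because isomorphism classes of split
extensions form a large type.) -/
def IsWeakRepresentation (X T : 𝒞) (τ : splExt X ⟶ yoneda.obj T ⋙ uliftFunctor.{w}) : Prop :=
  Mono τ

variable (𝒞) in
/-- Every object has a weak representation of actions. -/
def WeaklyActionRepresentable : Prop :=
  ∀ X : 𝒞, ∃ (T : 𝒞) (τ : splExt X ⟶ yoneda.obj T ⋙ uliftFunctor.{w}),
    IsWeakRepresentation X T τ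

end SplitExtensions

/-! ## The universal strict general actor -/

section Actor

variable {S : Signature.{u}}

/-- The self-maps `f` of `X` that can occur as `a ↦ b * a`, for an element `b` acting on `X` and
an operation `* ∈ Ω₂'`: they are additive with central values and commute with the unary
operations, which commute with each other on their values. -/
def MulMap (X : GCat S) : AddSubgroup (X → X) where
  carrier := {f | (∀ a b, f (a + b) = f a + f b) ∧ (∀ a b, f a + b = b + f a) ∧
    (∀ (ω : S.Un) a, f (GAlg.un ω a) = GAlg.un ω (f a)) ∧
    ∀ (ω ω' : S.Un) a, GAlg.un ω (GAlg.un ω' (f a)) = GAlg.un ω' (GAlg.un ω (f a))}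
  zero_mem' := by
    refine ⟨?_, ?_, ?_, ?_⟩ <;> intros <;> simp [GAlg.un_zero]
  add_mem' := by
    rintro f g ⟨f1, f2, f3, f4⟩ ⟨g1, g2, g3, g4⟩
    refine ⟨fun a b => ?_, fun a b => ?_, fun ω a => ?_, fun ω ω' a => ?_⟩
    · simp only [Pi.add_apply, f1, g1]
      rw [add_assoc, ← add_assoc (f b), f2 b (g a)]
      simp only [add_assoc]
    · simp only [Pi.add_apply]
      rw [add_assoc, g2, ← add_assoc, f2, add_assoc]
    · simp only [Pi.add_apply, f3, g3, GAlg.un_add]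
    · simp only [Pi.add_apply, GAlg.un_add, f4 ω ω', g4 ω ω']
  neg_mem' := by
    rintro f ⟨f1, f2, f3, f4⟩
    refine ⟨fun a b => ?_, fun a b => ?_, fun ω a => ?_, fun ω ω' a => ?_⟩
    · simp only [Pi.neg_apply, f1, neg_add_rev]
      rw [← neg_add_rev, ← neg_add_rev, f2 a (f b)]
    · simp only [Pi.neg_apply]
      rw [neg_add_eq_iff_eq_add, ← add_assoc, f2 a b, add_neg_cancel_right]
    · simp only [Pi.neg_apply, f3, GAlg.un_neg]
    · simp only [Pi.neg_apply, GAlg.un_neg, f4 ω ω']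

namespace MulMap

variable {X : GCat S}

theorem ext {f g : MulMap X} (h : ∀ a, f.1 a = g.1 a) : f = g := Subtype.ext (funext h)

theorem comm (f g : MulMap X) : f + g = g + f := ext fun a => f.2.2.1 a (g.1 a)

/-- The map `a ↦ ω (f a)`. -/
def un (ω : S.Un) (f : MulMap X) : MulMap X :=
  ⟨fun a => GAlg.un ω (f.1 a), by
    obtain ⟨f, f1, f2, f3, f4⟩ := f
    refine ⟨fun a b => ?_, fun a b => ?_, fun ω' a => ?_, fun ω' ω'' a => ?_⟩
    · simp only [f1, GAlg.un_add]
    · simp only [← f3, f2]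
    · simp only [f3, f4 ω ω']
    · simp only [← f3 ω, f4 ω' ω'']⟩

/-- The map `a ↦ f (g a)`. -/
def comp (f g : MulMap X) : MulMap X :=
  ⟨fun a => f.1 (g.1 a), by
    obtain ⟨f, f1, f2, f3, f4⟩ := f
    obtain ⟨g, g1, g2, g3, g4⟩ := g
    refine ⟨fun a b => ?_, fun a b => ?_, fun ω' a => ?_, fun ω' ω'' a => ?_⟩
    · simp only [g1, f1]
    · simp only [f2]
    · simp only [g3, f3]
    · simp only [f4 ω' ω'']⟩

/-- The maps `a ↦ b₁ (b₂ a)`, `a ↦ b₁ (a b₂)`, …, `a ↦ (a b₁) b₂`, where `f p` is the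
map `a ↦ b₁ * a` and `g p` is the map `a ↦ b₂ * a`, for `p` the operation `*`; note that
`a * b = b *° a`. -/
def mon (f g : S.Op → MulMap X) : Monomial S → MulMap X
  | .m1_23 p q => comp (f p) (g q)
  | .m1_32 p q => comp (f p) (g q.opp)
  | .m23_1 p q => comp (f p.opp) (g q)
  | .m32_1 p q => comp (f p.opp) (g q.opp)
  | .m2_13 p q => comp (g p) (f q)
  | .m2_31 p q => comp (g p) (f q.opp)
  | .m13_2 p q => comp (g p.opp) (f q)
  | .m31_2 p q => comp (g p.opp) (f q.opp)

theorem un_add (ω : S.Un) (f g : MulMap X) : un ω (f + g) = un ω f + un ω g :=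
  ext fun _ => GAlg.un_add _ _ _

theorem un_neg (ω : S.Un) (f : MulMap X) : un ω (-f) = -un ω f :=
  ext fun _ => GAlg.un_neg _ _

theorem un_zero (ω : S.Un) : un ω (0 : MulMap X) = 0 := ext fun _ => GAlg.un_zero _

theorem un_un (ω ω' : S.Un) (f : MulMap X) : un ω (un ω' f) = un ω' (un ω f) :=
  ext fun a => f.2.2.2.2 ω ω' a

theorem eval_add (W : OpWord S) (m m' : Monomial S → MulMap X) :
    W.eval un (fun i => m i + m' i) = W.eval un m + W.eval un m' := by
  induction W with
  | mon i => rfl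
  | zero => exact (add_zero _).symm
  | neg W ih =>
    simp only [OpWord.eval, ih, neg_add_rev]
    exact comm _ _
  | add W W' ih ih' =>
    simp only [OpWord.eval, ih, ih', add_assoc]
    rw [← add_assoc (W.eval un m'), comm (W.eval un m')]
    simp only [add_assoc]
  | un ω W ih => simp only [OpWord.eval, ih, un_add]

theorem eval_un (ω : S.Un) (W : OpWord S) (m : Monomial S → MulMap X) :
    W.eval un (fun i => un ω (m i)) = un ω (W.eval un m) := by
  induction W with
  | mon i => rfl
  | zero => exact (un_zero ω).symm
  | neg W ih => simp only [OpWord.eval, ih, un_neg]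
  | add W W' ih ih' => simp only [OpWord.eval, ih, ih', un_add]
  | un ω' W ih => simp only [OpWord.eval, ih, un_un ω]

theorem mon_add_left (f f' g : S.Op → MulMap X) :
    mon (fun p => f p + f' p) g = fun i => mon f g i + mon f' g i := by
  funext i
  cases i <;> refine ext fun a => ?_ <;>
    first | rfl | exact (g _).2.1 _ _

theorem mon_add_right (f g g' : S.Op → MulMap X) :
    mon f (fun p => g p + g' p) = fun i => mon f g i + mon f g' i := by
  funext i
  cases i <;> refine ext fun a => ?_ <;>
    first | rfl | exact (f _).2.1 _ _

theorem mon_un_left (ω : S.Un) (f g : S.Op → MulMap X) :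
    mon (fun p => un ω (f p)) g = fun i => un ω (mon f g i) := by
  funext i
  cases i <;> refine ext fun a => ?_ <;>
    first | rfl | exact (g _).2.2.2.1 _ _

theorem mon_un_right (ω : S.Un) (f g : S.Op → MulMap X) :
    mon f (fun p => un ω (g p)) = fun i => un ω (mon f g i) := by
  funext i
  cases i <;> refine ext fun a => ?_ <;>
    first | rfl | exact (f _).2.2.2.1 _ _

end MulMap

/-- Formal acting elements. Such a `t` consists of the maps `a ↦ t * a` on `X`, for all
`* ∈ Ω₂'`, and of the automorphisms `a ↦ (ω₁ ⋯ ωₙ t) · a` of the group `X`, for all composites of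
unary operations. (The automorphism `a ↦ t · a` alone does not determine `a ↦ (ω t) · a`.) -/
abbrev Acting (X : GCat S) : Type u :=
  (List S.Un → AddAut X) × (S.Op → MulMap X)

namespace Acting

variable {X : GCat S}

/-- The element `(ω₁ ⋯ ωₙ t) · a`. -/
def dotUns (t : Acting X) (l : List S.Un) (a : X) : X := t.1 l a

/-- The element `t · a`. -/
def dot (t : Acting X) (a : X) : X := t.dotUns [] a

/-- The element `t * a`, where `p` is the operation `*`. -/
def star (t : Acting X) (p : S.Op) (a : X) : X := (t.2 p).1 a

end Acting

variable {E : Identities S}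

/-- The object of `C_G` of all formal acting elements. The sum is characterised by
`(t + t') · a = t · (t' · a)` and `(t + t') * a = t * a + t' * a`. For a unary operation
`ω` one has `(ω t) * a = ω (t * a)`. The product `t * t'` acts by `(t * t') · a = a` and
by `(t * t') *' a = W(t(t'a), t(at'), …, (at)t')`, where `W` is the chosen word for the pair
of operations `(*, *')`. -/
def actingObj (W : ProductWords E) (X : GCat S) : GCat S where
  carrier := Acting X
  alg :=
    { un := fun ω t => (fun l => t.1 (l ++ [ω]), fun p => MulMap.un ω (t.2 p))
      bin := fun s t t' => (0, fun q => (W.word s q).eval MulMap.un (MulMap.mon t.2 t'.2))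
      bin_add := by
        intro s x y z
        refine Prod.ext (add_zero _).symm (funext fun q => ?_)
        exact (congrArg (fun m => (W.word s q).eval MulMap.un m) (MulMap.mon_add_right x.2 y.2 z.2)).trans
          (MulMap.eval_add _ _ _)
      add_bin := by
        intro s x y z
        refine Prod.ext (add_zero _).symm (funext fun q => ?_)
        exact (congrArg (fun m => (W.word s q).eval MulMap.un m) (MulMap.mon_add_left x.2 y.2 z.2)).trans
          (MulMap.eval_add _ _ _)
      un_add := by
        intro ω x y
        exact Prod.ext rfl (funext fun q => MulMap.un_add _ _ _)
      un_bin := by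
        intro ω s x y
        refine Prod.ext rfl (funext fun q => ?_)
        exact (congrArg (fun m => (W.word s q).eval MulMap.un m) (MulMap.mon_un_left ω x.2 y.2)).trans
          (MulMap.eval_un _ _ _)
      bin_un := by
        intro ω s x y
        refine Prod.ext rfl (funext fun q => ?_)
        exact (congrArg (fun m => (W.word s q).eval MulMap.un m) (MulMap.mon_un_right ω x.2 y.2)).trans
          (MulMap.eval_un _ _ _) }

/-- `t` acts on `X` as the element `b` of `B` does, in the derived action that is associated with
the split extension `e` of `B` by `X`: the elements `t · a` and `t * a` of `X` are
`β(b) + a - β(b)` and `β(b) * a`, where `X` is seen inside the extension. -/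
def ActsAs {B X : Variety E} (e : SplitExt B X) (b : B.obj) (t : Acting X.obj) : Prop :=
  (∀ a, e.k.hom (t.dot a) = e.β.hom b + e.k.hom a - e.β.hom b) ∧
    ∀ p a, e.k.hom (t.star p a) = GAlg.op p (e.β.hom b) (e.k.hom a)

/-- `t` is the formal acting element given by the element `b` of `B`, in the derived action that
is associated with the split extension `e` of `B` by `X`. -/
def IsInduced {B X : Variety E} (e : SplitExt B X) (b : B.obj) (t : Acting X.obj) : Prop :=
  ActsAs e b t ∧ ∀ l a, e.k.hom (t.dotUns l a) =
    e.β.hom (GAlg.uns l b) + e.k.hom a - e.β.hom (GAlg.uns l b)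

/-- The elements that are obtained by the operations of `C_G` from those given by elements of
objects of `C` which act on `X`. -/
inductive Generated (W : ProductWords E) (X : Variety E) : actingObj W X.obj → Prop
  | of {B : Variety E} (e : SplitExt B X) (b : B.obj) (t : actingObj W X.obj)
      (h : IsInduced e b t) : Generated W X t
  | zero : Generated W X 0
  | add (t t' : actingObj W X.obj) : Generated W X t → Generated W X t' → Generated W X (t + t')
  | neg (t : actingObj W X.obj) : Generated W X t → Generated W X (-t)
  | un (ω : S.Un) (t : actingObj W X.obj) : Generated W X t → Generated W X (GAlg.un ω t)
  | bin (s : S.Bin) (t t' : actingObj W X.obj) :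
      Generated W X t → Generated W X t' → Generated W X (GAlg.bin s t t')

/-- The universal strict general actor of `X`: the smallest subobject of the object of formal
acting elements that contains all elements given by actions on `X` in `C`. -/
def usga (W : ProductWords E) (X : Variety E) : GCat S :=
  (actingObj W X.obj).sub (Generated W X) .zero .add .neg .un .bin

/-- An element of the universal strict general actor, as a formal acting element. -/
def usga.val {W : ProductWords E} {X : Variety E} (t : usga W X) : Acting X.obj := t.1

/-- The functor `Hom_{C_G}(-, T)` on `C`. (The universe lift is as in
`IsWeakRepresentation`.) -/
abbrev homG (E : Identities S) (T : GCat S) : (Variety E)ᵒᵖ ⥤ Type (u + 1) :=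
  (E.Sat.ι.op ⋙ yoneda.obj T) ⋙ uliftFunctor.{u + 1}

/-- The morphism `B ⟶ T` of `C_G` that is given by an element of `Hom_{C_G}(B, T)`. -/
def homG.hom {T : GCat S} {B : Variety E} (φ : (homG E T).obj (op B)) : B.obj ⟶ T := φ.down

end Actor

/-! Let `e` be a split extension of `B` by `X`, with middle object `A`. Its kernel is closed under
conjugation by elements of `A` and under products with them. Every `b` therefore induces a family of
self-maps of `X` (`induced`), and injectivity of `k` makes this the only family satisfying
`IsInduced e b`. Every equation about induced families thus reduces to a computation inside `A`.

For `toUsga` to be a morphism, such a computation is needed for each operation. Sums and unary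
operations use only distributivity and compatibility. For a product, axiom 1 makes `β (b * c)` and
its images under unary operations central, so they conjugate trivially. Axiom 2 in `A`, at `β b`, `β
c` and `k a`, rewrites `(b * c) *' a` as the chosen word (`k_word`). Uniqueness holds because the
conjugation component at a list `l` is the plain action of `uns l t`, and morphisms commute with
unary operations (`eq_toUsga`). Naturality is the transport of `IsInduced` along the pullback
projection.

For injectivity, each element of `A` is uniquely `k x + β b`. In these coordinates the operations of
`A` are expressed by those of `X` and `B` and the induced action alone, so equal actions give
isomorphic extensions (`equivalent_of_induced_eq`). When the actor lies in `C`, fullness of `C` in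
`C_G` turns this monomorphism into a weak representation. -/

/-! ### Arithmetic of opposite operations, iterated unary operations and morphisms -/

namespace GAlg

variable {S : Signature.{u}} {A : Type u} [AddGroup A] [GAlg S A]

theorem op_add (p : S.Op) (x y z : A) : op p x (y + z) = op p x y + op p x z := by
  obtain ⟨s, _ | _⟩ := p
  · exact bin_add s x y z
  · exact add_bin s y z x

theorem add_op (p : S.Op) (x y z : A) : op p (x + y) z = op p x z + op p y z := by
  obtain ⟨s, _ | _⟩ := p
  · exact add_bin s x y z
  · exact bin_add s z x y

theorem op_un (p : S.Op) (ω : S.Un) (x y : A) : op p x (un ω y) = un ω (op p x y) := by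
  obtain ⟨s, _ | _⟩ := p
  · exact bin_un ω s x y
  · exact un_bin ω s y x

theorem un_op (p : S.Op) (ω : S.Un) (x y : A) : op p (un ω x) y = un ω (op p x y) := by
  obtain ⟨s, _ | _⟩ := p
  · exact un_bin ω s x y
  · exact bin_un ω s y x

theorem op_zero (p : S.Op) (x : A) : op p x 0 = 0 := by
  have h := op_add p x 0 0
  simpa using h

theorem op_opp (p : S.Op) (x y : A) : op p.opp x y = op p y x := by
  obtain ⟨s, _ | _⟩ := p <;> rfl

/-- Unary operations need not commute in general. On a product they do: one is absorbed by the left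
factor, the other by the right, and they come out again in either order. -/
theorem un_un_op (p : S.Op) (ω ω' : S.Un) (x y : A) :
    un ω (un ω' (op p x y)) = un ω' (un ω (op p x y)) := by
  rw [← op_un p ω', ← un_op p ω, ← un_op p ω, op_un p ω']

theorem uns_add (l : List S.Un) (x y : A) : uns l (x + y) = uns l x + uns l y := by
  induction l with
  | nil => rfl
  | cons ω l ih => simp only [uns, ih, un_add]

theorem uns_append (l l' : List S.Un) (x : A) : uns (l ++ l') x = uns l (uns l' x) := by
  induction l with
  | nil => rfl
  | cons ω l ih => simp only [List.cons_append, uns, ih]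

theorem uns_bin (l : List S.Un) (s : S.Bin) (x y : A) :
    uns l (bin s x y) = bin s (uns l x) y := by
  induction l with
  | nil => rfl
  | cons ω l ih => simp only [uns, ih, un_bin]

end GAlg

namespace GCat

variable {S : Signature.{u}} {A B : GCat S}

theorem hom_add (f : A ⟶ B) (x y : A) : f (x + y) = f x + f y := Hom.map_add f x y

theorem hom_sub (f : A ⟶ B) (x y : A) : f (x - y) = f x - f y := by
  rw [sub_eq_add_neg, hom_add, map_neg, ← sub_eq_add_neg]

theorem hom_un (f : A ⟶ B) (ω : S.Un) (x : A) : f (GAlg.un ω x) = GAlg.un ω (f x) :=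
  Hom.map_un f ω x

theorem hom_bin (f : A ⟶ B) (s : S.Bin) (x y : A) :
    f (GAlg.bin s x y) = GAlg.bin s (f x) (f y) :=
  Hom.map_bin f s x y

theorem hom_op (f : A ⟶ B) (p : S.Op) (x y : A) :
    f (GAlg.op p x y) = GAlg.op p (f x) (f y) := by
  obtain ⟨s, _ | _⟩ := p
  · exact hom_bin f s x y
  · exact hom_bin f s y x

theorem hom_uns (f : A ⟶ B) (l : List S.Un) (x : A) :
    f (GAlg.uns l x) = GAlg.uns l (f x) := by
  induction l with
  | nil => rfl
  | cons ω l ih => simp only [GAlg.uns, hom_un, ih]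

end GCat

/-! ### Split extensions in terms of elements -/

namespace Variety

variable {S : Signature.{u}} {E : Identities S}

/-- The kernel pair of `f` lies in the variety, and its two projections agree after composition with
`f`; hence they are equal, and two elements with the same image form a point of it. -/
theorem injective_of_mono {A B : Variety E} (f : A ⟶ B) [Mono f] :
    Function.Injective f.hom := by
  intro x y h
  let P : Variety E := ⟨pb f.hom f.hom, pb_sat f f⟩
  let p₁ : P ⟶ A := ⟨pbFst f.hom f.hom⟩
  let p₂ : P ⟶ A := ⟨pbSnd f.hom f.hom⟩
  have hp : p₁ = p₂ := (cancel_mono f).1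
    (ObjectProperty.hom_ext _ (GCat.hom_ext fun z => z.2))
  exact congrArg (fun m : P ⟶ A => m.hom (⟨(x, y), h⟩ : pb f.hom f.hom)) hp

end Variety

namespace SplitExt

variable {S : Signature.{u}} {E : Identities S} {B X : Variety E} (e : SplitExt B X)

theorem k_injective : Function.Injective e.k.hom := by
  obtain ⟨h⟩ := e.isKernel
  have : Mono e.k := mono_of_isLimit_fork h
  exact Variety.injective_of_mono e.k

theorem α_k (x : X.obj) : e.α.hom (e.k.hom x) = 0 :=
  congrArg (fun m : X ⟶ B => m.hom x) e.zero

theorem α_β (b : B.obj) : e.α.hom (e.β.hom b) = b :=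
  congrArg (fun m : B ⟶ B => m.hom b) e.section_comp

/-- The universal property of `k` is tested on the pullback of `α` along the zero map of `B`, an
object of the variety containing the point `(a, 0)`. Its projection to `A` is killed by `α`, so it
factors through `k`. -/
theorem exists_k_eq {a : e.A.obj} (ha : e.α.hom a = 0) : ∃ x, e.k.hom x = a := by
  obtain ⟨h⟩ := e.isKernel
  let P : Variety E := ⟨Variety.pb e.α.hom (0 : B ⟶ B).hom, Variety.pb_sat e.α 0⟩
  let p : P ⟶ e.A := ⟨Variety.pbFst e.α.hom (0 : B ⟶ B).hom⟩
  have hp : p ≫ e.α = 0 := ObjectProperty.hom_ext _ (GCat.hom_ext fun z => z.2)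
  obtain ⟨l, hl⟩ := KernelFork.IsLimit.lift' h p hp
  exact ⟨l.hom (⟨(a, 0), ha⟩ : Variety.pb e.α.hom (0 : B ⟶ B).hom),
    congrArg (fun m : P ⟶ e.A => m.hom
      (⟨(a, 0), ha⟩ : Variety.pb e.α.hom (0 : B ⟶ B).hom)) hl⟩

theorem α_conj (a : e.A.obj) (x : X.obj) : e.α.hom (a + e.k.hom x - a) = 0 := by
  rw [GCat.hom_sub, GCat.hom_add, e.α_k, add_zero, sub_self]

theorem α_op (p : S.Op) (a : e.A.obj) (x : X.obj) :
    e.α.hom (GAlg.op p a (e.k.hom x)) = 0 := by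
  rw [GCat.hom_op, e.α_k, GAlg.op_zero]

/-- Conjugation on `X` by an element of the extension. -/
noncomputable def conj (a : e.A.obj) (x : X.obj) : X.obj :=
  (e.exists_k_eq (e.α_conj a x)).choose

theorem k_conj (a : e.A.obj) (x : X.obj) :
    e.k.hom (e.conj a x) = a + e.k.hom x - a :=
  (e.exists_k_eq (e.α_conj a x)).choose_spec

/-- Conjugation by an element of the extension, as an automorphism of the group `X`. -/
noncomputable def conjAut (a : e.A.obj) : AddAut X.obj where
  toFun := e.conj a
  invFun := e.conj (-a)
  left_inv x := e.k_injective <| by simp [k_conj, sub_eq_add_neg, add_assoc]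
  right_inv x := e.k_injective <| by simp [k_conj, sub_eq_add_neg, add_assoc]
  map_add' x y := e.k_injective <| by
    simp [k_conj, GCat.hom_add, sub_eq_add_neg, add_assoc]

/-- The product of an element of the extension and an element of `X`. -/
noncomputable def mul (p : S.Op) (a : e.A.obj) (x : X.obj) : X.obj :=
  (e.exists_k_eq (e.α_op p a x)).choose

theorem k_mul (p : S.Op) (a : e.A.obj) (x : X.obj) :
    e.k.hom (e.mul p a x) = GAlg.op p a (e.k.hom x) :=
  (e.exists_k_eq (e.α_op p a x)).choose_spec

/-- The product with an element of the extension, as a self-map of `X`. -/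
noncomputable def mulMap (hE : IsCategoryOfInterest E) (p : S.Op) (a : e.A.obj) :
    MulMap X.obj :=
  ⟨e.mul p a, fun x y => e.k_injective <| by
      simp only [k_mul, GCat.hom_add, GAlg.op_add],
    fun x y => e.k_injective <| by
      simp only [k_mul, GCat.hom_add]
      exact (hE.axiom1 e.A p _ _ _).symm,
    fun ω x => e.k_injective <| by simp only [k_mul, GCat.hom_un, GAlg.op_un],
    fun ω ω' x => e.k_injective <| by
      simp only [k_mul, GCat.hom_un]
      exact GAlg.un_un_op p ω ω' _ _⟩

/-- The formal acting element that is given by an element of `B`. -/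
noncomputable def induced (hE : IsCategoryOfInterest E) (b : B.obj) : Acting X.obj :=
  (fun l => e.conjAut (e.β.hom (GAlg.uns l b)), fun p => e.mulMap hE p (e.β.hom b))

theorem isInduced_induced (hE : IsCategoryOfInterest E) (b : B.obj) :
    IsInduced e b (e.induced hE b) :=
  ⟨⟨fun a => e.k_conj _ a, fun p a => e.k_mul p _ a⟩, fun _ a => e.k_conj _ a⟩

end SplitExt

/-! ### Uniqueness, transport and word computations for induced elements -/

section

variable {S : Signature.{u}} {E : Identities S} {X : Variety E}

theorem Acting.ext {X : GCat S} {t t' : Acting X} (h : ∀ l a, t.dotUns l a = t'.dotUns l a)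
    (h' : ∀ p a, t.star p a = t'.star p a) : t = t' :=
  Prod.ext (funext fun l => AddEquiv.ext (h l)) (funext fun p => MulMap.ext (h' p))

/-- Both families become the same expressions in the middle object, where `k` is injective. -/
theorem IsInduced.unique {B : Variety E} {e : SplitExt B X} {b : B.obj}
    {t t' : Acting X.obj} (h : IsInduced e b t) (h' : IsInduced e b t') : t = t' :=
  Acting.ext (fun l a => e.k_injective ((h.2 l a).trans (h'.2 l a).symm))
    fun p a => e.k_injective ((h.1.2 p a).trans (h'.1.2 p a).symm)

/-- Formal acting elements are preserved along morphisms of split extensions. -/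
theorem IsInduced.map {B B' : Variety E} {e : SplitExt B X} {e' : SplitExt B' X}
    (g : e.A ⟶ e'.A) (f : B ⟶ B') (hk : e.k ≫ g = e'.k) (hβ : e.β ≫ g = f ≫ e'.β)
    {b : B.obj} {t : Acting X.obj} (h : IsInduced e b t) : IsInduced e' (f.hom b) t := by
  have hk' (x : X.obj) : e'.k.hom x = g.hom (e.k.hom x) :=
    (congrArg (fun m : X ⟶ e'.A => m.hom x) hk).symm
  have hβ' (x : B.obj) : e'.β.hom (f.hom x) = g.hom (e.β.hom x) :=
    (congrArg (fun m : B ⟶ e'.A => m.hom x) hβ).symm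
  refine ⟨⟨fun a => ?_, fun p a => ?_⟩, fun l a => ?_⟩
  · rw [hk', h.1.1, hβ', hk', GCat.hom_sub, GCat.hom_add]
  · rw [hk', h.1.2, hβ', hk', GCat.hom_op]
  · rw [hk', h.2, ← GCat.hom_uns, hβ', hk', GCat.hom_sub, GCat.hom_add]

theorem OpWord.map_eval {H H' : Type u} [AddGroup H] [AddGroup H'] (f : H →+ H')
    (θ : S.Un → H → H) (θ' : S.Un → H' → H') (hθ : ∀ ω x, f (θ ω x) = θ' ω (f x))
    (m : Monomial S → H) (W : OpWord S) :
    f (W.eval θ m) = W.eval θ' fun i => f (m i) := by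
  induction W with
  | mon i => rfl
  | zero => exact f.map_zero
  | neg W ih => exact (f.map_neg _).trans (congrArg _ ih)
  | add W W' ih ih' => exact (f.map_add _ _).trans (congrArg₂ _ ih ih')
  | un ω W ih => exact (hθ _ _).trans (congrArg _ ih)

namespace SplitExt

variable {B : Variety E} (e : SplitExt B X) (hE : IsCategoryOfInterest E)

theorem induced_eq {b : B.obj} {t : Acting X.obj} (h : IsInduced e b t) : e.induced hE b = t :=
  (e.isInduced_induced hE b).unique h

/-- The opposites in `MulMap.mon` occur where the element of `X` stands to the left of `b` or `c`;
`GAlg.op_opp` restores that order. -/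
theorem k_mon (b c : B.obj) (x : X.obj) (i : Monomial S) :
    e.k.hom ((MulMap.mon (e.induced hE b).2 (e.induced hE c).2 i).1 x) =
      Monomial.eval (e.β.hom b) (e.β.hom c) (e.k.hom x) i := by
  have hs (p : S.Op) (b : B.obj) (x : X.obj) :
      e.k.hom (((e.induced hE b).2 p).1 x) = GAlg.op p (e.β.hom b) (e.k.hom x) :=
    e.k_mul p _ x
  cases i <;> simp [MulMap.mon, MulMap.comp, hs, Monomial.eval, GAlg.op_opp]

theorem k_word (b c : B.obj) (x : X.obj) (W : OpWord S) :
    e.k.hom ((W.eval MulMap.un (MulMap.mon (e.induced hE b).2 (e.induced hE c).2)).1 x) =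
      W.eval GAlg.un (Monomial.eval (e.β.hom b) (e.β.hom c) (e.k.hom x)) := by
  -- Evaluation at `x` followed by `k` is additive and respects unary operations, so it passes
  -- through the word down to the monomials.
  let f : MulMap X.obj →+ e.A.obj.carrier :=
    { toFun := fun t => e.k.hom (t.1 x)
      map_zero' := GCat.map_zero e.k.hom
      map_add' := fun _ _ => GCat.hom_add e.k.hom _ _ }
  refine (OpWord.map_eval f MulMap.un GAlg.un (fun ω t => GCat.hom_un e.k.hom ω _) _ W).trans ?_
  exact congrArg (fun m => OpWord.eval GAlg.un m W) (funext fun i => e.k_mon hE b c x i)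

/-! ### The morphism to the actor: uniqueness and naturality -/

variable (W : ProductWords E)

/-- The morphism from `B` to the universal strict general actor that is given by an action. -/
noncomputable def toUsga : B.obj ⟶ usga W X :=
  GCat.Hom.mk (B := usga W X)
    (fun b => ⟨e.induced hE b, .of e b _ (e.isInduced_induced hE b)⟩)
    (fun b c => Subtype.ext <| e.induced_eq hE <| by
      have hb := e.isInduced_induced hE b
      have hc := e.isInduced_induced hE c
      have key (l : List S.Un) (a : X.obj) :
          e.k.hom ((e.induced hE b).dotUns l ((e.induced hE c).dotUns l a)) =
            e.β.hom (GAlg.uns l (b + c)) + e.k.hom a - e.β.hom (GAlg.uns l (b + c)) := by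
        rw [hb.2, hc.2, GAlg.uns_add, GCat.hom_add]
        simp [sub_eq_add_neg, add_assoc]
      refine ⟨⟨key [], fun p a => ?_⟩, key⟩
      refine (GCat.hom_add e.k.hom _ _).trans
        ((congrArg₂ (· + ·) (hb.1.2 p a) (hc.1.2 p a)).trans ?_)
      rw [GCat.hom_add, GAlg.add_op])
    (fun ω b => Subtype.ext <| e.induced_eq hE <| by
      have hb := e.isInduced_induced hE b
      -- In `ω₁ ⋯ ωₙ (ω b)` the operation `ω` is applied first, so it goes at the end of the list.
      have key (l : List S.Un) (a : X.obj) :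
          e.k.hom ((e.induced hE b).dotUns (l ++ [ω]) a) =
            e.β.hom (GAlg.uns l (GAlg.un ω b)) + e.k.hom a -
              e.β.hom (GAlg.uns l (GAlg.un ω b)) := by
        rw [hb.2, GAlg.uns_append]
        rfl
      refine ⟨⟨key [], fun p a => ?_⟩, key⟩
      refine (GCat.hom_un e.k.hom ω _).trans ((congrArg _ (hb.1.2 p a)).trans ?_)
      rw [GCat.hom_un, GAlg.un_op])
    (fun s b c => Subtype.ext <| e.induced_eq hE <| by
      -- Unary operations move into the first factor, so the conjugating element is still a product,
      -- hence central by axiom 1.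
      have key (l : List S.Un) (a : X.obj) :
          e.k.hom a = e.β.hom (GAlg.uns l (GAlg.bin s b c)) + e.k.hom a -
              e.β.hom (GAlg.uns l (GAlg.bin s b c)) := by
        rw [GAlg.uns_bin, GCat.hom_bin, eq_sub_iff_add_eq]
        exact hE.axiom1 e.A (s, false) _ _ _
      refine ⟨⟨key [], fun p a => ?_⟩, key⟩
      refine (e.k_word hE b c a _).trans ?_
      rw [GCat.hom_bin]
      -- Axiom 2 is used in the middle object, which belongs to the variety.
      exact (W.isProductWord s p e.A _ _ _).symm)

theorem actsAs_toUsga (b : B.obj) : ActsAs e b (usga.val (e.toUsga hE W b)) :=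
  (e.isInduced_induced hE b).1

theorem dotUns_eq (t : usga W X) (l : List S.Un) :
    (usga.val t).dotUns l = (usga.val (GAlg.uns l t)).dot := by
  -- The prefix `m` must vary: peeling `ω` off `l` appends it to `m`.
  have h (l m : List S.Un) :
      (usga.val t).dotUns (m ++ l) = (usga.val (GAlg.uns l t)).dotUns m := by
    induction l generalizing m with
    | nil => rw [List.append_nil]; rfl
    | cons ω l ih => exact (congrArg _ (List.append_cons m ω l)).trans (ih (m ++ [ω]))
  exact h l []

/-- `ActsAs` fixes only the conjugation component at the empty list. The component at `l` is
recovered from the hypothesis at `uns l b`, since `φ` commutes with unary operations. -/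
theorem eq_toUsga (φ : B.obj ⟶ usga W X) (h : ∀ b : B.obj, ActsAs e b (usga.val (φ b))) :
    φ = e.toUsga hE W :=
  GCat.hom_ext fun b => Subtype.ext <| Eq.symm <| e.induced_eq hE
    ⟨h b, fun l a => by
      have h' := (h (GAlg.uns l b)).1 a
      rw [GCat.hom_uns, ← dotUns_eq] at h'
      exact h'⟩

theorem toUsga_baseChange {B' : Variety E} (f : B' ⟶ B) :
    (e.baseChange f).toUsga hE W = f.hom ≫ e.toUsga hE W :=
  GCat.hom_ext fun b => Subtype.ext <| Eq.symm <| e.induced_eq hE <|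
    ((e.baseChange f).isInduced_induced hE b).map (pullback.fst e.α f) f
      (pullback.lift_fst _ _ _) (pullback.lift_fst _ _ _)

theorem toUsga_eq_of_equivalent {e e' : SplitExt B X} (h : e.Equivalent e') :
    e.toUsga hE W = e'.toUsga hE W := by
  obtain ⟨i, h₁, -, h₃⟩ := h
  exact GCat.hom_ext fun b => Subtype.ext <| Eq.symm <| e'.induced_eq hE <|
    (e.isInduced_induced hE b).map i.hom (𝟙 B) h₁ (h₃.trans (Category.id_comp _).symm)

/-! ### Reconstruction of a split extension from its action -/

/-- The component in `X` of an element of a split extension. -/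
noncomputable def kerPart (a : e.A.obj) : X.obj :=
  (e.exists_k_eq (a := a - e.β.hom (e.α.hom a))
    (by rw [GCat.hom_sub, e.α_β, sub_self])).choose

theorem k_kerPart_add (a : e.A.obj) :
    e.k.hom (e.kerPart a) + e.β.hom (e.α.hom a) = a := by
  have h : e.k.hom (e.kerPart a) = a - e.β.hom (e.α.hom a) :=
    (e.exists_k_eq (a := a - e.β.hom (e.α.hom a))
      (by rw [GCat.hom_sub, e.α_β, sub_self])).choose_spec
  rw [h, sub_add_cancel]

theorem α_k_add_β (x : X.obj) (b : B.obj) : e.α.hom (e.k.hom x + e.β.hom b) = b := by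
  rw [GCat.hom_add, e.α_k, e.α_β, zero_add]

theorem kerPart_k_add_β (x : X.obj) (b : B.obj) :
    e.kerPart (e.k.hom x + e.β.hom b) = x := by
  have h := e.k_kerPart_add (e.k.hom x + e.β.hom b)
  rw [e.α_k_add_β] at h
  exact e.k_injective (add_right_cancel h)

theorem exists_k_add_β (a : e.A.obj) : ∃ x b, a = e.k.hom x + e.β.hom b :=
  ⟨_, _, (e.k_kerPart_add a).symm⟩

/-- Moving `β b` past `k y` conjugates `k y`, as in a semidirect product. -/
theorem k_add_β_add (x y : X.obj) (b c : B.obj) :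
    (e.k.hom x + e.β.hom b) + (e.k.hom y + e.β.hom c) =
      e.k.hom (x + (e.induced hE b).dot y) + e.β.hom (b + c) := by
  rw [GCat.hom_add, GCat.hom_add, (e.isInduced_induced hE b).1.1]
  simp [sub_eq_add_neg, add_assoc]

theorem un_k_add_β (ω : S.Un) (x : X.obj) (b : B.obj) :
    GAlg.un ω (e.k.hom x + e.β.hom b) = e.k.hom (GAlg.un ω x) + e.β.hom (GAlg.un ω b) := by
  rw [GCat.hom_un, GCat.hom_un, GAlg.un_add]

/-- Distributivity gives four products. The two mixed ones appear in the other order and are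
exchanged by axiom 1; the one with its `X`-factor on the left is an action through the opposite
operation. -/
theorem bin_k_add_β (s : S.Bin) (x y : X.obj) (b c : B.obj) :
    GAlg.bin s (e.k.hom x + e.β.hom b) (e.k.hom y + e.β.hom c) =
      e.k.hom (GAlg.bin s x y + (e.induced hE b).star (s, false) y +
        (e.induced hE c).star (s, true) x) + e.β.hom (GAlg.bin s b c) := by
  rw [GCat.hom_add, GCat.hom_add, (e.isInduced_induced hE b).1.2,
    (e.isInduced_induced hE c).1.2, GCat.hom_bin, GCat.hom_bin, GAlg.add_bin, GAlg.bin_add,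
    GAlg.bin_add, add_assoc, add_assoc, add_assoc]
  congr 1
  simp only [GAlg.op]
  rw [← add_assoc, ← add_assoc]
  congr 1
  exact hE.axiom1 e.A (s, false) _ _ _

/-- The map `k x + β b ↦ k' x + β' b` between split extensions with equal actions. -/
noncomputable def compare (e e' : SplitExt B X) (h : ∀ b, e.induced hE b = e'.induced hE b) :
    e.A ⟶ e'.A :=
  -- In the coordinates `(x, b)` the map is the identity, so compatibility with each operation
  -- follows from the coordinate formulas on both sides.
  have H (x : X.obj) (b : B.obj) :
      e'.k.hom (e.kerPart (e.k.hom x + e.β.hom b)) +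
        e'.β.hom (e.α.hom (e.k.hom x + e.β.hom b)) = e'.k.hom x + e'.β.hom b := by
    rw [e.kerPart_k_add_β, e.α_k_add_β]
  ⟨GCat.Hom.mk (fun a => e'.k.hom (e.kerPart a) + e'.β.hom (e.α.hom a))
    (fun a a' => by
      obtain ⟨x, b, rfl⟩ := e.exists_k_add_β a
      obtain ⟨y, c, rfl⟩ := e.exists_k_add_β a'
      rw [e.k_add_β_add hE, H, H, H, e'.k_add_β_add hE, h])
    (fun ω a => by
      obtain ⟨x, b, rfl⟩ := e.exists_k_add_β a
      rw [e.un_k_add_β, H, H, e'.un_k_add_β])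
    (fun s a a' => by
      obtain ⟨x, b, rfl⟩ := e.exists_k_add_β a
      obtain ⟨y, c, rfl⟩ := e.exists_k_add_β a'
      rw [e.bin_k_add_β hE, H, H, H, e'.bin_k_add_β hE, h, h])⟩

theorem compare_k_add_β (e e' : SplitExt B X) (h : ∀ b, e.induced hE b = e'.induced hE b)
    (x : X.obj) (b : B.obj) :
    (compare hE e e' h).hom (e.k.hom x + e.β.hom b) = e'.k.hom x + e'.β.hom b := by
  change e'.k.hom (e.kerPart (e.k.hom x + e.β.hom b)) +
    e'.β.hom (e.α.hom (e.k.hom x + e.β.hom b)) = _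
  rw [e.kerPart_k_add_β, e.α_k_add_β]

theorem compare_comp_compare (e e' : SplitExt B X)
    (h : ∀ b, e.induced hE b = e'.induced hE b) :
    compare hE e e' h ≫ compare hE e' e (fun b => (h b).symm) = 𝟙 e.A := by
  refine ObjectProperty.hom_ext _ (GCat.hom_ext fun a => ?_)
  obtain ⟨x, b, rfl⟩ := e.exists_k_add_β a
  change (compare hE e' e fun b => (h b).symm).hom ((compare hE e e' h).hom _) = _
  rw [compare_k_add_β, compare_k_add_β]
  rfl

/-- Split extensions with equal actions are isomorphic. -/
theorem equivalent_of_induced_eq (e e' : SplitExt B X)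
    (h : ∀ b, e.induced hE b = e'.induced hE b) : e.Equivalent e' := by
  refine ⟨⟨compare hE e e' h, compare hE e' e fun b => (h b).symm,
    compare_comp_compare hE e e' h, compare_comp_compare hE e' e _⟩, ?_, ?_, ?_⟩
  · refine ObjectProperty.hom_ext _ (GCat.hom_ext fun x => ?_)
    have := compare_k_add_β hE e e' h x 0
    rwa [GCat.map_zero, GCat.map_zero, add_zero, add_zero] at this
  · refine ObjectProperty.hom_ext _ (GCat.hom_ext fun a => ?_)
    obtain ⟨x, b, rfl⟩ := e.exists_k_add_β a
    change e'.α.hom ((compare hE e e' h).hom _) = _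
    rw [compare_k_add_β, e.α_k_add_β, e'.α_k_add_β]
  · refine ObjectProperty.hom_ext _ (GCat.hom_ext fun b => ?_)
    have := compare_k_add_β hE e e' h 0 b
    rwa [GCat.map_zero, GCat.map_zero, zero_add, zero_add] at this

theorem equivalent_of_toUsga_eq {e e' : SplitExt B X} (h : e.toUsga hE W = e'.toUsga hE W) :
    e.Equivalent e' :=
  equivalent_of_induced_eq hE e e' fun b =>
    congrArg (fun φ : B.obj ⟶ usga W X => usga.val (φ b)) h

/-! ### The monomorphism of functors and the weak representation -/

/-- The natural transformation from actions on `X` to morphisms into the universal strict general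
actor. -/
noncomputable def actorTrans (X : Variety E) : splExt X ⟶ homG E (usga W X) where
  app B := ↾(Quotient.lift (fun e : SplitExt (unop B) X => ULift.up (e.toUsga hE W))
    fun _ _ h => congrArg ULift.up (toUsga_eq_of_equivalent hE W h))
  naturality B B' f := by
    ext e
    induction e using Quotient.inductionOn with
    | h e => exact congrArg ULift.up (e.toUsga_baseChange hE W f.unop)

theorem actorTrans_app_injective (X : Variety E) (B : (Variety E)ᵒᵖ) :
    Function.Injective ((actorTrans hE W X).app B) := by
  intro ξ ξ' h
  induction ξ using Quotient.inductionOn with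
  | h e =>
  induction ξ' using Quotient.inductionOn with
  | h e' => exact Quotient.sound (equivalent_of_toUsga_eq hE W (congrArg ULift.down h))

/-- The weak representation that is obtained when the universal strict general actor is an object
of the category. -/
noncomputable def weakRepr (X : Variety E) (h : E.Sat (usga W X)) :
    splExt X ⟶ yoneda.obj (⟨usga W X, h⟩ : Variety E) ⋙ uliftFunctor.{u + 1} where
  app B := ↾(fun ξ => ULift.up ⟨homG.hom ((actorTrans hE W X).app (op (unop B)) ξ)⟩)
  naturality B B' f := by
    ext e
    induction e using Quotient.inductionOn with
    | h e =>
      exact congrArg ULift.up (ObjectProperty.hom_ext _ (e.toUsga_baseChange hE W f.unop))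

theorem isWeakRepresentation_weakRepr (X : Variety E) (h : E.Sat (usga W X)) :
    IsWeakRepresentation X ⟨usga W X, h⟩ (weakRepr hE W X h) := by
  refine (NatTrans.mono_iff_mono_app _).2 fun B => (mono_iff_injective _).2 fun ξ ξ' hξ => ?_
  refine actorTrans_app_injective hE W X B (ULift.ext _ _ ?_)
  exact congrArg (fun φ => φ.down.hom) hξ

end SplitExt

end

theorem mainTheorem6 {S : Signature.{u}} (E : Identities S) (hE : IsCategoryOfInterest E)
    (W : ProductWords E) :
    (∀ X : Variety E, ∃ τ : splExt X ⟶ homG E (usga W X),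
      (∀ (B : Variety E) (e : SplitExt B X),
        (∀ b : B.obj, ActsAs e b (usga.val (homG.hom (τ.app (op B) ⟦e⟧) b))) ∧
        ∀ φ : B.obj ⟶ usga W X, (∀ b : B.obj, ActsAs e b (usga.val (φ b))) →
          φ = homG.hom (τ.app (op B) ⟦e⟧)) ∧
      Mono τ ∧
      ∀ h : E.Sat (usga W X),
        ∃ τ' : splExt X ⟶ yoneda.obj (⟨usga W X, h⟩ : Variety E) ⋙ uliftFunctor.{u + 1},
          (∀ (B : Variety E) (ξ : (splExt X).obj (op B)),
            (τ'.app (op B) ξ).down.hom = homG.hom (τ.app (op B) ξ)) ∧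
          IsWeakRepresentation X ⟨usga W X, h⟩ τ') ∧
    ((∀ X : Variety E, E.Sat (usga W X)) → WeaklyActionRepresentable (Variety E)) := by
  refine ⟨fun X => ⟨SplitExt.actorTrans hE W X, fun B e => ⟨e.actsAs_toUsga hE W,
    e.eq_toUsga hE W⟩, ?_, fun h => ⟨SplitExt.weakRepr hE W X h, fun B ξ => rfl,
    SplitExt.isWeakRepresentation_weakRepr hE W X h⟩⟩,
    fun h X => ⟨⟨usga W X, h X⟩, SplitExt.weakRepr hE W X (h X),
      SplitExt.isWeakRepresentation_weakRepr hE W X (h X)⟩⟩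
  exact (NatTrans.mono_iff_mono_app _).2 fun B =>
    (mono_iff_injective _).2 (SplitExt.actorTrans_app_injective hE W X B)
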